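/- Let $\mathfrak A$ be a unital $C^*$-algebra, let $\theta,\alpha\in\mathrm{Aut}(\mathfrak A)$ be $*$-automorphisms, and let $u\in\mathfrak A$ be a unitary such that $u\,\alpha(\theta(a))=\theta(\alpha(a))\,u$ for all $a\in\mathfrak A$. Let $\mathfrak A\rtimes_\alpha\mathbb Z$ be the $C^*$-crossed product (the maximal $C^*$-completion of the $*$-algebra of finite sums $\sum_n a_nV^n$, $a_n\in\mathfrak A$, where $V$ is a unitary with $VaV^*=\alpha(a)$), and let $\Phi_{\theta,u}$ be the $*$-automorphism of $\mathfrak A\rtimes_\alpha\mathbb Z$ determined by $\Phi_{\theta,u}(a)=\theta(a)$ for $a\in\mathfrak A$ and $\Phi_{\theta,u}(V)=uV$. For $n\in\mathbb Z$ let $u_n\in\mathfrak A$ be the unitary with $(uV)^n=u_nV^n$, that is, $u_0=1$, $u_n=u\,\alpha(u)\cdots\alpha^{n-1}(u)$ for $n\ge 1$, and $u_n=\alpha^{-1}(u^*)\alpha^{-2}(u^*)\cdots\alpha^{n}(u^*)$ for $n<0$. Suppose that $(\mathfrak A,\theta)$ is uniquely ergodic, that is, it has exactly one $\theta$-invariant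 state $\omega_o$. Let $(\mathcal H_{\omega_o},\pi_{\omega_o},\xi_{\omega_o})$ be the GNS representation of $\omega_o$, and let $V_{\omega_o,\theta}$ be the unitary on $\mathcal H_{\omega_o}$ with $V_{\omega_o,\theta}\pi_{\omega_o}(a)\xi_{\omega_o}=\pi_{\omega_o}(\theta(a))\xi_{\omega_o}$ for all $a\in\mathfrak A$. Suppose moreover that $(\mathfrak A\rtimes_\alpha\mathbb Z,\Phi_{\theta,u})$ is uniquely ergodic with respect to its fixed-point subalgebra, that is, every bounded linear functional on $(\mathfrak A\rtimes_\alpha\mathbb Z)^{\Phi_{\theta,u}}=\{x:\Phi_{\theta,u}(x)=x\}$ has a unique bounded $\Phi_{\theta,u}$-invariant linear extension to $\mathfrak A\rtimes_\alpha\mathbb Z$. Then for every $n\in\mathbb Z$ and every $\eta\in\mathcal H_{\omega_o}$ with $$\pi_{\omega_o}(\alpha^{-n}(u_n))\,V_{\omega_o,\theta}\,\eta=\eta$$ there is $a\in\mathfrak A$ with $$\alpha^{-n}(u_n)\,\theta(a)=a\qquad\text{and}\qquad \eta=\pi_{\omega_o}(a)\xi_{\omega_o}.$$ -/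

import Mathlib

open scoped ComplexOrder

/-! ### The enveloping C⋆-algebra of a ⋆-algebra with respect to a C⋆-seminorm -/

/-- A C⋆-seminorm on a complex unital ⋆-algebra. -/
structure CStarSeminorm (B : Type*) [Ring B] [Algebra ℂ B] [StarRing B] extends
    Seminorm ℂ B where
  mul_le' : ∀ x y, toFun (x * y) ≤ toFun x * toFun y
  star_mul_self' : ∀ x, toFun (star x * x) = toFun x * toFun x

namespace CStarSeminorm

section Completion

variable {B : Type*} [Ring B] [Algebra ℂ B] [StarRing B] (p : CStarSeminorm B)

instance : CoeFun (CStarSeminorm B) (fun _ => B → ℝ) := ⟨fun p => p.toFun⟩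

theorem nonneg (x : B) : 0 ≤ p x := apply_nonneg p.toSeminorm x

theorem map_zero : p 0 = 0 := _root_.map_zero p.toSeminorm

theorem add_le (x y : B) : p (x + y) ≤ p x + p y := map_add_le_add p.toSeminorm x y

theorem map_smul (c : ℂ) (x : B) : p (c • x) = ‖c‖ * p x := map_smul_eq_mul p.toSeminorm c x

theorem le_star (x : B) : p x ≤ p (star x) := by
  have h1 := p.star_mul_self' x
  have h2 := p.mul_le' (star x) x
  rcases (p.nonneg x).eq_or_lt with h | h
  · change p x ≤ p (star x)
    rw [← h]
    exact p.nonneg _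
  · rw [h1] at h2
    exact le_of_mul_le_mul_right h2 h

theorem star_eq (x : B) : p (star x) = p x :=
  le_antisymm (by simpa using p.le_star (star x)) (p.le_star x)

/-- The ⋆-algebra `B`, regarded as a seminormed algebra with the seminorm `p`. -/
@[nolint unusedArguments]
def Carrier (_p : CStarSeminorm B) : Type _ := B

instance : Ring p.Carrier := inferInstanceAs (Ring B)
instance : Algebra ℂ p.Carrier := inferInstanceAs (Algebra ℂ B)
instance : StarRing p.Carrier := inferInstanceAs (StarRing B)
instance [StarModule ℂ B] : StarModule ℂ p.Carrier := inferInstanceAs (StarModule ℂ B)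

noncomputable instance : SeminormedRing p.Carrier where
  __ := (inferInstance : Ring p.Carrier)
  __ := AddGroupSeminorm.toSeminormedAddCommGroup
    (E := p.Carrier) p.toSeminorm.toAddGroupSeminorm
  norm_mul_le := p.mul_le'

/-- The identity map from `B` to its seminormed copy. -/
def toCarrier : B ≃⋆ₐ[ℂ] p.Carrier := StarAlgEquiv.refl ℂ B

theorem norm_toCarrier (x : B) : ‖p.toCarrier x‖ = p x := rfl

theorem norm_def (x : p.Carrier) : ‖x‖ = p x := rfl

noncomputable instance : NormedAlgebra ℂ p.Carrier where
  __ := (inferInstance : Algebra ℂ p.Carrier)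
  norm_smul_le c x := (p.map_smul c x).le

instance : NormedStarGroup p.Carrier where
  norm_star_le x := (p.star_eq x).le

/-- The Hausdorff completion of `B` with respect to the C⋆-seminorm `p`. -/
abbrev Enveloping : Type _ := UniformSpace.Completion p.Carrier

open UniformSpace

noncomputable instance : Star p.Enveloping := ⟨Completion.map star⟩

theorem coe_star (x : p.Carrier) : ((star x : p.Carrier) : p.Enveloping) = star (x : p.Enveloping) :=
  (Completion.map_coe (starNormedAddGroupHom (E := p.Carrier)).uniformContinuous x).symm

theorem continuous_star : Continuous (star : p.Enveloping → p.Enveloping) :=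
  Completion.continuous_map

noncomputable instance : StarRing p.Enveloping where
  star_involutive x := by
    induction x using Completion.induction_on with
    | hp => exact isClosed_eq (p.continuous_star.comp p.continuous_star) continuous_id
    | ih x => rw [← coe_star, ← coe_star, star_star]
  star_mul x y := by
    induction x, y using Completion.induction_on₂ with
    | hp =>
      have := p.continuous_star
      exact isClosed_eq (by fun_prop) (by fun_prop)
    | ih x y => simp only [← coe_star, ← Completion.coe_mul, star_mul]
  star_add x y := by
    induction x, y using Completion.induction_on₂ with
    | hp =>
      have := p.continuous_star
      exact isClosed_eq (by fun_prop) (by fun_prop)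
    | ih x y => simp only [← coe_star, ← Completion.coe_add, star_add]

instance : CStarRing p.Enveloping where
  norm_mul_self_le x := by
    induction x using Completion.induction_on with
    | hp =>
      have := p.continuous_star
      exact isClosed_le (by fun_prop) (by fun_prop)
    | ih x =>
      simp only [← coe_star, ← Completion.coe_mul, Completion.norm_coe]
      exact (p.star_mul_self' x).ge

noncomputable instance : NormedAlgebra ℂ p.Enveloping where
  norm_smul_le := norm_smul_le

theorem smul_coe (c : ℂ) (x : p.Carrier) :
    ((c • x : p.Carrier) : p.Enveloping) = c • (x : p.Enveloping) :=
  Completion.coe_smul c x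

instance [StarModule ℂ B] : StarModule ℂ p.Enveloping where
  star_smul c x := by
    induction x using Completion.induction_on with
    | hp =>
      exact isClosed_eq (p.continuous_star.comp (continuous_const_smul c))
        ((continuous_const_smul (star c)).comp p.continuous_star)
    | ih x =>
      rw [← smul_coe, ← coe_star, ← coe_star, ← smul_coe, star_smul]

noncomputable instance [StarModule ℂ B] : CStarAlgebra p.Enveloping where

/-- The canonical ⋆-homomorphism of `B` into its completion. -/
noncomputable def toEnveloping : B →⋆ₐ[ℂ] p.Enveloping where
  toFun x := (p.toCarrier x : p.Enveloping)
  map_one' := Completion.coe_one p.Carrier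
  map_mul' x y := Completion.coe_mul (p.toCarrier x) (p.toCarrier y)
  map_zero' := Completion.coe_zero
  map_add' x y := Completion.coe_add (p.toCarrier x) (p.toCarrier y)
  commutes' _ := rfl
  map_star' x := p.coe_star (p.toCarrier x)

theorem norm_toEnveloping (x : B) : ‖p.toEnveloping x‖ = p x :=
  Completion.norm_coe (p.toCarrier x)

/-- The pullback of a C⋆-seminorm along a ⋆-homomorphism. -/
noncomputable def comap {C : Type*} [Ring C] [Algebra ℂ C] [StarRing C] (f : C →⋆ₐ[ℂ] B) : CStarSeminorm C where
  toSeminorm := p.toSeminorm.comp f.toAlgHom.toLinearMap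
  mul_le' x y := by
    change p (f (x * y)) ≤ p (f x) * p (f y)
    rw [map_mul]; exact p.mul_le' _ _
  star_mul_self' x := by
    change p (f (star x * x)) = p (f x) * p (f x)
    rw [map_mul, map_star]; exact p.star_mul_self' _

/-- A C⋆-seminorm on a C⋆-algebra is dominated by the norm. -/
theorem le_norm {A : Type*} [CStarAlgebra A] (q : CStarSeminorm A) (a : A) : q a ≤ ‖a‖ := by
  rw [← q.norm_toEnveloping]
  exact NonUnitalStarAlgHom.norm_apply_le q.toEnveloping a

/-- A ⋆-endomorphism of `B`, regarded as an endomorphism of the seminormed algebra. -/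
def carrierMap (f : B →⋆ₐ[ℂ] B) : p.Carrier →⋆ₐ[ℂ] p.Carrier :=
  (p.toCarrier : B →⋆ₐ[ℂ] p.Carrier).comp (f.comp (p.toCarrier.symm : p.Carrier →⋆ₐ[ℂ] B))

theorem continuous_carrierMap (f : B →⋆ₐ[ℂ] B) (hf : ∀ x, p (f x) ≤ p x) :
    Continuous (p.carrierMap f : p.Carrier →+* p.Carrier) :=
  AddMonoidHomClass.continuous_of_bound (p.carrierMap f : p.Carrier →+* p.Carrier) 1
    (fun x => by rw [one_mul]; exact hf (p.toCarrier.symm x))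

theorem uniformContinuous_carrierMap (f : B →⋆ₐ[ℂ] B) (hf : ∀ x, p (f x) ≤ p x) :
    UniformContinuous (p.carrierMap f : p.Carrier →+* p.Carrier) :=
  uniformContinuous_addMonoidHom_of_continuous (p.continuous_carrierMap f hf)

/-- A ⋆-endomorphism which does not increase the C⋆-seminorm `p` extends to the completion. -/
noncomputable def extend (f : B →⋆ₐ[ℂ] B) (hf : ∀ x, p (f x) ≤ p x) :
    p.Enveloping →⋆ₐ[ℂ] p.Enveloping where
  __ := Completion.mapRingHom (p.carrierMap f : p.Carrier →+* p.Carrier)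
    (p.continuous_carrierMap f hf)
  commutes' r :=
    (Completion.mapRingHom_coe (p.continuous_carrierMap f hf) (algebraMap ℂ p.Carrier r)).trans
      (congrArg _ ((p.carrierMap f).commutes' r))
  map_star' x := by
    change Completion.map (p.carrierMap f : p.Carrier →+* p.Carrier) (star x) =
      star (Completion.map (p.carrierMap f : p.Carrier →+* p.Carrier) x)
    have hu := p.uniformContinuous_carrierMap f hf
    induction x using Completion.induction_on with
    | hp =>
      exact isClosed_eq (Completion.continuous_map.comp p.continuous_star)
        (p.continuous_star.comp Completion.continuous_map)
    | ih x =>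
      rw [← coe_star, Completion.map_coe hu, Completion.map_coe hu, ← coe_star]
      exact congrArg _ ((p.carrierMap f).map_star' x)

theorem extend_toEnveloping (f : B →⋆ₐ[ℂ] B) (hf : ∀ x, p (f x) ≤ p x) (x : B) :
    p.extend f hf (p.toEnveloping x) = p.toEnveloping (f x) :=
  Completion.map_coe (p.uniformContinuous_carrierMap f hf) (p.toCarrier x)

end Completion

end CStarSeminorm

/-! ### The crossed product of a C⋆-algebra by an automorphism -/

section CrossedProduct

variable {A : Type*} [CStarAlgebra A]

/-- The action `n ↦ αⁿ` of `ℤ` on `A`. -/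
@[reducible] def zAction (α : A ≃⋆ₐ[ℂ] A) : MulSemiringAction (Multiplicative ℤ) A where
  smul n a := (α ^ n.toAdd) a
  one_smul a := by change (α ^ (0 : ℤ)) a = a; simp
  mul_smul m n a := by
    change (α ^ (m.toAdd + n.toAdd)) a = (α ^ m.toAdd) ((α ^ n.toAdd) a)
    rw [zpow_add]; rfl
  smul_zero n := map_zero (α ^ n.toAdd)
  smul_add n := map_add (α ^ n.toAdd)
  smul_one n := map_one (α ^ n.toAdd)
  smul_mul n := map_mul (α ^ n.toAdd)

/-- The ⋆-algebra of the finite formal sums `∑ₙ aₙ Vⁿ` with `aₙ ∈ A`, where `V` is a unitary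
with `V a V⋆ = α(a)`. -/
def FiniteSums (_α : A ≃⋆ₐ[ℂ] A) : Type _ := SkewMonoidAlgebra A (Multiplicative ℤ)

namespace FiniteSums

variable (α : A ≃⋆ₐ[ℂ] A)

noncomputable instance : Ring (FiniteSums α) :=
  letI := zAction α
  inferInstanceAs (Ring (SkewMonoidAlgebra A (Multiplicative ℤ)))

theorem smulCommClass : letI := zAction α; SMulCommClass (Multiplicative ℤ) ℂ A :=
  letI := zAction α
  ⟨fun n c a => map_smul (α ^ n.toAdd) c a⟩

noncomputable instance : Algebra ℂ (FiniteSums α) :=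
  letI := zAction α
  haveI := smulCommClass α
  (inferInstance : Algebra ℂ (SkewMonoidAlgebra A (Multiplicative ℤ)))

/-- The monomial `a Vⁿ`. -/
noncomputable def mon (n : ℤ) (a : A) : FiniteSums α :=
  SkewMonoidAlgebra.single (Multiplicative.ofAdd n) a

theorem mon_add (n : ℤ) (a b : A) : mon α n (a + b) = mon α n a + mon α n b :=
  SkewMonoidAlgebra.single_add _ _ _

theorem mon_zero (n : ℤ) : mon α n 0 = 0 :=
  SkewMonoidAlgebra.single_zero_right _

theorem mon_smul (c : ℂ) (n : ℤ) (a : A) : mon α n (c • a) = c • mon α n a :=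
  (SkewMonoidAlgebra.smul_single c (Multiplicative.ofAdd n) a).symm

theorem mon_one : mon α 0 1 = 1 := rfl

theorem mon_mul_mon (m n : ℤ) (a b : A) :
    mon α m a * mon α n b = mon α (m + n) (a * (α ^ m) b) := by
  let := zAction α
  exact SkewMonoidAlgebra.single_mul_single (k := A) (G := Multiplicative ℤ)

variable {α} in
theorem induction {p : FiniteSums α → Prop} (x : FiniteSums α) (hm : ∀ n a, p (mon α n a))
    (ha : ∀ x y, p x → p y → p (x + y)) : p x :=
  SkewMonoidAlgebra.induction_on (k := A) (G := Multiplicative ℤ) (p := p) x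
    (by have := hm 0 0; rwa [mon_zero] at this) (fun n a => hm n.toAdd a)
    (fun {x y} hx hy => ha x y hx hy)

/-- The additive map underlying the involution, `(a Vⁿ)⋆ = V⁻ⁿ a⋆ = α⁻ⁿ(a⋆) V⁻ⁿ`. -/
noncomputable def starAux : FiniteSums α →+ FiniteSums α where
  toFun x := SkewMonoidAlgebra.sum x fun n a => mon α (-n.toAdd) ((α ^ (-n.toAdd)) (star a))
  map_zero' := SkewMonoidAlgebra.sum_zero_index
  map_add' x y := SkewMonoidAlgebra.sum_add_index'
    (fun n => by rw [star_zero, map_zero, mon_zero])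
    (fun n a b => by rw [star_add, map_add, mon_add])

noncomputable instance : Star (FiniteSums α) := ⟨starAux α⟩

theorem star_mon (n : ℤ) (a : A) : star (mon α n a) = mon α (-n) ((α ^ (-n)) (star a)) :=
  SkewMonoidAlgebra.sum_single_index (a := Multiplicative.ofAdd n)
    (h := fun n a => mon α (-n.toAdd) ((α ^ (-n.toAdd)) (star a)))
    (by rw [star_zero, map_zero, mon_zero])

theorem zpow_zpow_apply (m n : ℤ) (a : A) : (α ^ m) ((α ^ n) a) = (α ^ (m + n)) a := by
  rw [zpow_add]; rfl

noncomputable instance : StarRing (FiniteSums α) where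
  star_involutive x := by
    change starAux α (starAux α x) = x
    induction x using induction with
    | hm n a =>
      change star (star (mon α n a)) = _
      rw [star_mon, star_mon, ← map_star, star_star, zpow_zpow_apply]; simp
    | ha x y hx hy => rw [map_add, map_add, hx, hy]
  star_add x y := map_add (starAux α) x y
  star_mul x y := by
    change starAux α (x * y) = starAux α y * starAux α x
    induction x using induction with
    | ha x₁ x₂ h₁ h₂ => rw [add_mul, map_add, map_add, mul_add, h₁, h₂]
    | hm m a =>
      induction y using induction with
      | ha y₁ y₂ h₁ h₂ => rw [mul_add, map_add, map_add, add_mul, h₁, h₂]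
      | hm n b =>
        rw [mon_mul_mon]
        change star _ = star (mon α n b) * star (mon α m a)
        rw [star_mon, star_mon, star_mon, mon_mul_mon, star_mul, map_mul, ← map_star,
          zpow_zpow_apply, zpow_zpow_apply]
        rw [show -n + -m = -(m + n) by ring, show -(m + n) + m = -n by ring]

instance : StarModule ℂ (FiniteSums α) where
  star_smul c x := by
    change starAux α (c • x) = star c • starAux α x
    induction x using induction with
    | ha x₁ x₂ h₁ h₂ => rw [smul_add, map_add, map_add, smul_add, h₁, h₂]
    | hm m a =>
      rw [← mon_smul]
      change star _ = _ • star _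
      rw [star_mon, star_mon, star_smul, _root_.map_smul, mon_smul]

/-- The inclusion of `A`. -/
noncomputable def incl : A →⋆ₐ[ℂ] FiniteSums α where
  toFun a := mon α 0 a
  map_one' := mon_one α
  map_mul' a b := by rw [mon_mul_mon]; simp
  map_zero' := mon_zero α 0
  map_add' := mon_add α 0
  commutes' c := by
    rw [Algebra.algebraMap_eq_smul_one, Algebra.algebraMap_eq_smul_one, mon_smul, mon_one]
  map_star' a := by rw [star_mon]; simp

/-- The unitary `V`. -/
noncomputable def gen : unitary (FiniteSums α) :=
  ⟨mon α 1 1, by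
    constructor <;> rw [star_mon, mon_mul_mon] <;> simp [mon_one]⟩

theorem gen_mul_incl (a : A) : (gen α : FiniteSums α) * incl α a = incl α (α a) * gen α := by
  change mon α 1 1 * mon α 0 a = mon α 0 (α a) * mon α 1 1
  rw [mon_mul_mon, mon_mul_mon]; simp

/-- Every C⋆-seminorm is bounded at each finite sum; the bound does not depend on the seminorm. -/
theorem bddAbove (x : FiniteSums α) :
    BddAbove (Set.range fun p : CStarSeminorm (FiniteSums α) => p x) := by
  induction x using induction with
  | hm n a =>
    refine ⟨‖a‖, ?_⟩
    rintro _ ⟨p, rfl⟩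
    have h : p (mon α n a) * p (mon α n a) ≤ ‖a‖ * ‖a‖ := by
      rw [← p.star_mul_self', star_mon, mon_mul_mon]
      have := (p.comap (incl α)).le_norm ((α ^ (-n)) (star a) * (α ^ (-n)) a)
      rw [← map_mul] at this ⊢
      rw [neg_add_cancel]
      refine this.trans ?_
      rw [← CStarRing.norm_star_mul_self]
      exact NonUnitalStarAlgHom.norm_apply_le (α ^ (-n)) _
    exact le_of_not_gt fun hlt => h.not_gt (mul_self_lt_mul_self (norm_nonneg a) hlt)
  | ha x y hx hy =>
    obtain ⟨C, hC⟩ := hx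
    obtain ⟨D, hD⟩ := hy
    refine ⟨C + D, ?_⟩
    rintro _ ⟨p, rfl⟩
    exact (p.add_le x y).trans (add_le_add (hC ⟨p, rfl⟩) (hD ⟨p, rfl⟩))

instance {B : Type*} [Ring B] [Algebra ℂ B] [StarRing B] : Nonempty (CStarSeminorm B) :=
  ⟨{ toSeminorm := 0
     mul_le' := fun _ _ => by change (0 : ℝ) ≤ 0 * 0; simp
     star_mul_self' := fun _ => by change (0 : ℝ) = 0 * 0; simp }⟩

/-- The maximal C⋆-seminorm on the ⋆-algebra of finite sums: the supremum of all C⋆-seminorms. -/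
noncomputable def maxSeminorm : CStarSeminorm (FiniteSums α) where
  toFun x := ⨆ p : CStarSeminorm (FiniteSums α), p x
  map_zero' := by simp only [CStarSeminorm.map_zero, ciSup_const]
  add_le' x y := ciSup_le fun p =>
    (p.add_le x y).trans (add_le_add (le_ciSup (bddAbove α x) p) (le_ciSup (bddAbove α y) p))
  neg' x := by
    congr 1; funext p
    exact map_neg_eq_map p.toSeminorm x
  smul' c x := by
    rw [Real.mul_iSup_of_nonneg (norm_nonneg c)]
    congr 1; funext p
    exact p.map_smul c x
  mul_le' x y := ciSup_le fun p => (p.mul_le' x y).trans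
    (mul_le_mul (le_ciSup (bddAbove α x) p) (le_ciSup (bddAbove α y) p) (p.nonneg y)
      ((p.nonneg x).trans (le_ciSup (bddAbove α x) p)))
  star_mul_self' x := by
    have hx := bddAbove α x
    have hxx := bddAbove α (star x * x)
    have h0 : ∀ p : CStarSeminorm (FiniteSums α), 0 ≤ p x := fun p => p.nonneg x
    apply le_antisymm
    · refine ciSup_le fun p => (p.star_mul_self' x).le.trans ?_
      exact mul_self_le_mul_self (h0 p) (le_ciSup hx p)
    · have hS : 0 ≤ ⨆ p : CStarSeminorm (FiniteSums α), p (star x * x) :=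
        Real.iSup_nonneg fun p => p.nonneg _
      have hM : (⨆ p : CStarSeminorm (FiniteSums α), p x) ≤
          √(⨆ p : CStarSeminorm (FiniteSums α), p (star x * x)) := by
        refine ciSup_le fun p => Real.le_sqrt_of_sq_le ?_
        rw [sq, ← p.star_mul_self']
        exact le_ciSup hxx p
      calc _ ≤ _ := mul_self_le_mul_self (Real.iSup_nonneg h0) hM
        _ = _ := Real.mul_self_sqrt hS

theorem le_maxSeminorm (p : CStarSeminorm (FiniteSums α)) (x : FiniteSums α) :
    p x ≤ maxSeminorm α x := le_ciSup (bddAbove α x) p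

theorem maxSeminorm_map_le (f : FiniteSums α →⋆ₐ[ℂ] FiniteSums α) (x : FiniteSums α) :
    maxSeminorm α (f x) ≤ maxSeminorm α x :=
  le_maxSeminorm α ((maxSeminorm α).comap f) x

section Lift

variable {R : Type*} [Ring R] [Algebra ℂ R] [StarRing R]
  (ρ : A →⋆ₐ[ℂ] R) (W : unitary R)

theorem zpow_mul_eq (hW : ∀ a, (W : R) * ρ a = ρ (α a) * W) (n : ℤ) (a : A) :
    ((W ^ n : unitary R) : R) * ρ a = ρ ((α ^ n) a) * (W ^ n : unitary R) := by
  have hW' : ∀ a, ((W⁻¹ : unitary R) : R) * ρ a = ρ (α⁻¹ a) * (W⁻¹ : unitary R) := fun a => by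
    have h := hW (α⁻¹ a)
    have h1 : α (α⁻¹ a) = a := α.apply_symm_apply a
    rw [h1] at h
    have h2 : ((W⁻¹ : unitary R) : R) * W = 1 := by rw [← Submonoid.coe_mul]; simp
    have h3 : (W : R) * ((W⁻¹ : unitary R) : R) = 1 := by rw [← Submonoid.coe_mul]; simp
    calc ((W⁻¹ : unitary R) : R) * ρ a
        = ((W⁻¹ : unitary R) : R) * (ρ a * W) * (W⁻¹ : unitary R) := by
          rw [mul_assoc, mul_assoc, h3, mul_one]
      _ = ρ (α⁻¹ a) * (W⁻¹ : unitary R) := by rw [← h, ← mul_assoc, h2, one_mul]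
  induction n generalizing a with
  | zero => simp
  | succ n ih =>
    rw [zpow_add_one, zpow_add_one, Submonoid.coe_mul, mul_assoc, hW, ← mul_assoc, ih, mul_assoc]
    rfl
  | pred n ih =>
    rw [zpow_sub_one, zpow_sub_one, Submonoid.coe_mul, mul_assoc, hW', ← mul_assoc, ih, mul_assoc]
    rfl

/-- The ⋆-homomorphism `∑ₙ aₙ Vⁿ ↦ ∑ₙ ρ(aₙ) Wⁿ` defined by a covariant pair `(ρ, W)`. -/
noncomputable def lift (hW : ∀ a, (W : R) * ρ a = ρ (α a) * W) : FiniteSums α →⋆ₐ[ℂ] R :=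
  letI := zAction α
  haveI := smulCommClass α
  let g : Multiplicative ℤ →* R := (unitary R).subtype.comp (zpowersHom (unitary R) W)
  let F : SkewMonoidAlgebra A (Multiplicative ℤ) →ₐ[ℂ] R :=
    SkewMonoidAlgebra.liftNCAlgHom ρ.toAlgHom g
      (fun {a n} => (zpow_mul_eq α ρ W hW n.toAdd a).symm)
  { toFun := fun x => F x
    map_one' := map_one F
    map_mul' := map_mul F
    map_zero' := map_zero F
    map_add' := map_add F
    commutes' := F.commutes
    map_star' := fun x => by
      have hF : ∀ n a, F (mon α n a) = ρ a * ((W ^ n : unitary R) : R) := fun n a =>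
        SkewMonoidAlgebra.liftNC_single _ _ _ _
      induction x using induction with
      | hm n a =>
        rw [star_mon]
        refine (hF _ _).trans ?_
        refine Eq.trans ?_ (congrArg star (hF n a)).symm
        rw [star_mul, ← map_star, ← zpow_mul_eq α ρ W hW, zpow_neg]
        rfl
      | ha x y hx hy =>
        rw [star_add]
        refine (map_add F _ _).trans ?_
        refine Eq.trans ?_ (congrArg star (map_add F x y)).symm
        rw [star_add]
        exact congrArg₂ (· + ·) hx hy }

theorem lift_mon (hW : ∀ a, (W : R) * ρ a = ρ (α a) * W) (n : ℤ) (a : A) :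
    lift α ρ W hW (mon α n a) = ρ a * ((W ^ n : unitary R) : R) :=
  letI := zAction α
  SkewMonoidAlgebra.liftNC_single _ _ _ _

end Lift

end FiniteSums

/-- The crossed product `A ⋊_α ℤ`: the completion of the ⋆-algebra of finite sums with respect to
the maximal C⋆-seminorm. -/
abbrev CrossedProduct (α : A ≃⋆ₐ[ℂ] A) : Type _ := (FiniteSums.maxSeminorm α).Enveloping

namespace CrossedProduct

variable (α : A ≃⋆ₐ[ℂ] A)

/-- The canonical embedding of `A` into `A ⋊_α ℤ`. -/
noncomputable def incl : A →⋆ₐ[ℂ] CrossedProduct α :=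
  (FiniteSums.maxSeminorm α).toEnveloping.comp (FiniteSums.incl α)

/-- The unitary `V` of `A ⋊_α ℤ` implementing `α`. -/
noncomputable def gen : unitary (CrossedProduct α) :=
  ⟨(FiniteSums.maxSeminorm α).toEnveloping (FiniteSums.gen α : FiniteSums α), by
    constructor
    · rw [← map_star, ← map_mul, (FiniteSums.gen α).2.1, map_one]
    · rw [← map_star, ← map_mul, (FiniteSums.gen α).2.2, map_one]⟩

theorem gen_mul_incl (a : A) :
    (gen α : CrossedProduct α) * incl α a = incl α (α a) * gen α := by
  have h := congrArg (FiniteSums.maxSeminorm α).toEnveloping (FiniteSums.gen_mul_incl α a)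
  rw [map_mul, map_mul] at h
  exact h

end CrossedProduct

section SkewProduct

variable (θ α : A ≃⋆ₐ[ℂ] A) (u : unitary A)

/-- The unitary `u V` of the ⋆-algebra of finite sums. -/
noncomputable def twistedGen : unitary (FiniteSums α) :=
  ⟨FiniteSums.incl α u, by
    constructor
    · rw [← map_star, ← map_mul, u.2.1, map_one]
    · rw [← map_star, ← map_mul, u.2.2, map_one]⟩ * FiniteSums.gen α

theorem twistedGen_mul (hu : ∀ a, (u : A) * α (θ a) = θ (α a) * u) (a : A) :
    (twistedGen α u : FiniteSums α) * (FiniteSums.incl α).comp (θ : A →⋆ₐ[ℂ] A) a =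
      (FiniteSums.incl α).comp (θ : A →⋆ₐ[ℂ] A) (α a) * twistedGen α u := by
  change FiniteSums.incl α u * (FiniteSums.gen α : FiniteSums α) * FiniteSums.incl α (θ a) =
    FiniteSums.incl α (θ (α a)) * (FiniteSums.incl α u * (FiniteSums.gen α : FiniteSums α))
  rw [mul_assoc, FiniteSums.gen_mul_incl, ← mul_assoc, ← mul_assoc, ← map_mul, ← map_mul, hu]

/-- The skew product `Φ_{θ,u}` on finite sums, `∑ₙ aₙ Vⁿ ↦ ∑ₙ θ(aₙ) (u V)ⁿ`. -/
noncomputable def skewProductFinite (hu : ∀ a, (u : A) * α (θ a) = θ (α a) * u) :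
    FiniteSums α →⋆ₐ[ℂ] FiniteSums α :=
  FiniteSums.lift α ((FiniteSums.incl α).comp (θ : A →⋆ₐ[ℂ] A)) (twistedGen α u)
    (twistedGen_mul θ α u hu)

/-- The skew product `Φ_{θ,u}` on `A ⋊_α ℤ`, the continuous extension of
`∑ₙ aₙ Vⁿ ↦ ∑ₙ θ(aₙ) (u V)ⁿ`. -/
noncomputable def skewProduct (hu : ∀ a, (u : A) * α (θ a) = θ (α a) * u) :
    CrossedProduct α →⋆ₐ[ℂ] CrossedProduct α :=
  (FiniteSums.maxSeminorm α).extend (skewProductFinite θ α u hu)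
    (FiniteSums.maxSeminorm_map_le α _)

theorem skewProduct_incl (hu : ∀ a, (u : A) * α (θ a) = θ (α a) * u) (a : A) :
    skewProduct θ α u hu (CrossedProduct.incl α a) = CrossedProduct.incl α (θ a) := by
  refine ((FiniteSums.maxSeminorm α).extend_toEnveloping _ _ _).trans ?_
  refine congrArg (FiniteSums.maxSeminorm α).toEnveloping ?_
  refine (FiniteSums.lift_mon α _ _ _ 0 a).trans ?_
  simp

theorem skewProduct_gen (hu : ∀ a, (u : A) * α (θ a) = θ (α a) * u) :
    skewProduct θ α u hu (CrossedProduct.gen α : CrossedProduct α) =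
      CrossedProduct.incl α u * (CrossedProduct.gen α : CrossedProduct α) := by
  refine ((FiniteSums.maxSeminorm α).extend_toEnveloping _ _ _).trans ?_
  refine (congrArg (FiniteSums.maxSeminorm α).toEnveloping
    ((FiniteSums.lift_mon α _ _ _ 1 1).trans ?_)).trans (map_mul _ _ _)
  simp [twistedGen]

/-- The unitaries `u_n` with `(u V)ⁿ = u_n Vⁿ`: `u_n = u α(u) ⋯ αⁿ⁻¹(u)` for `n ≥ 0`, and
`u_n = α⁻¹(u⋆) α⁻²(u⋆) ⋯ αⁿ(u⋆)` for `n < 0`. -/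
def skewCocycle : ℤ → A
  | Int.ofNat n => ((List.range n).map fun k => (α ^ k) (u : A)).prod
  | Int.negSucc n => ((List.range (n + 1)).map fun k => (α ^ (-((k : ℤ) + 1))) (star (u : A))).prod

end SkewProduct

end CrossedProduct

/-! ### Unique ergodicity -/

section UniqueErgodicity

/-- The state `ω` is the unique state of `A` invariant under the automorphism `θ`. -/
structure IsUniquelyErgodic {A : Type*} [CStarAlgebra A] [PartialOrder A] [StarOrderedRing A]
    (θ : A ≃⋆ₐ[ℂ] A) (ω : A →ₚ[ℂ] ℂ) : Prop where
  map_one : ω 1 = 1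
  invariant : ∀ a, ω (θ a) = ω a
  unique : ∀ φ : A →ₚ[ℂ] ℂ, φ 1 = 1 → (∀ a, φ (θ a) = φ a) → φ = ω

/-- The C⋆-dynamical system `(B, Φ)` is uniquely ergodic with respect to its fixed-point
subalgebra `B^Φ = {x | Φ x = x}`: every bounded linear functional on `B^Φ` has a unique bounded
`Φ`-invariant linear extension to `B`. -/
def IsUniquelyErgodicRelFixed {B : Type*} [CStarAlgebra B] (Φ : B →⋆ₐ[ℂ] B) : Prop :=
  ∀ f : StarAlgHom.equalizer Φ (StarAlgHom.id ℂ B) →L[ℂ] ℂ,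
    ∃! g : B →L[ℂ] ℂ, (∀ b, g (Φ b) = g b) ∧
      ∀ x : StarAlgHom.equalizer Φ (StarAlgHom.id ℂ B), g (x : B) = f x

end UniqueErgodicity

/-! ### The covariant GNS representation -/

section GNS

variable {A : Type*} [CStarAlgebra A] [PartialOrder A] [StarOrderedRing A]

/-- The cyclic vector `ξ_ω` of the GNS representation. -/
noncomputable def gnsVector (ω : A →ₚ[ℂ] ℂ) : ω.GNS := (ω.toPreGNS 1 : ω.GNS)

theorem gnsStarAlgHom_gnsVector (ω : A →ₚ[ℂ] ℂ) (a : A) :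
    ω.gnsStarAlgHom a (gnsVector ω) = (ω.toPreGNS a : ω.GNS) := by
  change ω.gnsNonUnitalStarAlgHom a (ω.toPreGNS 1 : ω.GNS) = _
  rw [ω.gnsNonUnitalStarAlgHom_apply_coe]
  simp

variable (θ : A ≃⋆ₐ[ℂ] A) (ω : A →ₚ[ℂ] ℂ) (h : ∀ a, ω (θ a) = ω a)

/-- The isometry `a ↦ θ(a)` of the pre-Hilbert space `A` with inner product `ω(a⋆ b)`. -/
noncomputable def preCovariantIsometry : ω.PreGNS →ₗᵢ[ℂ] ω.PreGNS where
  toLinearMap := ω.toPreGNS.toLinearMap ∘ₗ θ.toAlgEquiv.toLinearMap ∘ₗ ω.ofPreGNS.toLinearMap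
  norm_map' a := by
    rw [ω.preGNS_norm_def, ω.preGNS_norm_def]
    change √(ω (star (θ (ω.ofPreGNS a)) * θ (ω.ofPreGNS a))).re = _
    rw [← map_star, ← map_mul, h]

/-- The operator `V_{ω,θ}` of the covariant GNS representation, determined by
`V_{ω,θ} π_ω(a) ξ_ω = π_ω(θ(a)) ξ_ω`. -/
noncomputable def covariantUnitary : ω.GNS →L[ℂ] ω.GNS :=
  (preCovariantIsometry θ ω h).toContinuousLinearMap.completion

theorem covariantUnitary_gns (a : A) :
    covariantUnitary θ ω h (ω.gnsStarAlgHom a (gnsVector ω)) =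
      ω.gnsStarAlgHom (θ a) (gnsVector ω) := by
  rw [gnsStarAlgHom_gnsVector, gnsStarAlgHom_gnsVector]
  exact ContinuousLinearMap.completion_apply_coe _ _

end GNS

/-! ### States, invariant averages and fixed points -/

section States

open Filter Topology

variable {A : Type*} [CStarAlgebra A]

/-! Put `w = α⁻ⁿ(u_n)`. The `n`-th coefficient map `∑ₖ Vᵏ bₖ ↦ bₙ` extends to a bounded map on the
crossed product and intertwines `Φ_{θ,u}` with `a ↦ w θ(a)` (`coefficient_skewProduct`). Composed
with `a ↦ π_ω(a) ξ_ω`, it becomes a bounded map `E` intertwining `Φ_{θ,u}` with the isometry `U =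
π_ω(w) V_{ω,θ}`.

Relative unique ergodicity makes fixed points plus coboundaries `y - Φ y` dense
(`exists_norm_sub_lt`). Approximate `η` by some `E b`, and `b` by `x + (y - Φ y)` with `Φ x = x`.
Since `η - E x` is `U`-fixed, it is orthogonal to the coboundaries of `U`, so discarding `E y - U (E
y)` costs nothing and `E x` is close to `η` (`norm_le_norm_add_sub_map`). Thus `η` is a limit of
vectors `π_ω(a) ξ_ω` with `w θ(a) = a`.

These vectors form a closed set. If `w θ(a) = a`, then `a⋆ a` is `θ`-fixed, hence a scalar by unique
ergodicity (`IsUniquelyErgodic.eq_smul_one`), so `‖π_ω(a) ξ_ω‖ = ‖a‖` and the fixed points embed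
isometrically. -/

theorem im_apply_eq_zero_of_isSelfAdjoint {g : A →L[ℂ] ℂ} (h1 : g 1 = 1) (hg : ‖g‖ ≤ 1) {a : A}
    (ha : IsSelfAdjoint a) : (g a).im = 0 := by
  -- Adding `i s 1` shifts the imaginary part of `g a` by `s`, while the squared norm grows by at
  -- most `s² ‖1‖`. The term linear in `s` must therefore vanish.
  have key : ∀ s : ℝ, (g a).re ^ 2 + ((g a).im + s) ^ 2 ≤ ‖a‖ ^ 2 + s ^ 2 * ‖(1 : A)‖ := by
    intro s
    have hle : ‖g (a + (s * Complex.I) • (1 : A))‖ ≤ ‖a + (s * Complex.I) • (1 : A)‖ := by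
      simpa using g.le_of_opNorm_le hg (a + (s * Complex.I) • (1 : A))
    have hsq : ‖a + (s * Complex.I) • (1 : A)‖ ^ 2 ≤ ‖a‖ ^ 2 + s ^ 2 * ‖(1 : A)‖ := by
      rw [sq, ← CStarRing.norm_star_mul_self]
      have : star (a + (s * Complex.I) • (1 : A)) * (a + (s * Complex.I) • (1 : A))
          = a * a + ((s : ℂ) ^ 2) • (1 : A) := by
        have h2 : star ((s : ℂ) * Complex.I) = -(s * Complex.I) := by simp
        have h3 : (s : ℂ) ^ 2 = -((s : ℂ) * Complex.I) * (s * Complex.I) := by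
          ring_nf; simp
        rw [star_add, ha.star_eq, star_smul, star_one, h2, h3]
        simp only [add_mul, mul_add, smul_mul_assoc, mul_smul_comm, one_mul, mul_one]
        module
      rw [this]
      refine (norm_add_le _ _).trans (add_le_add ((norm_mul_le _ _).trans_eq (sq _).symm) ?_)
      rw [norm_smul]; simp
    have hval : ‖g (a + (s * Complex.I) • (1 : A))‖ ^ 2 = (g a).re ^ 2 + ((g a).im + s) ^ 2 := by
      rw [map_add, map_smul, h1, Complex.sq_norm, Complex.normSq_apply]
      simp; ring
    rw [← hval]
    exact (pow_le_pow_left₀ (norm_nonneg _) hle 2).trans hsq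
  have hone : ‖(1 : A)‖ ≤ 1 := by
    rcases subsingleton_or_nontrivial A with h | h
    · rw [Subsingleton.elim (1 : A) 0]; simp
    · exact CStarRing.norm_one.le
  by_contra hne
  -- This `s` makes the cross term `2 s Im (g a)` equal to `‖a‖² + 1`, too large once `s²` cancels.
  have h2 := key ((‖a‖ ^ 2 + 1) / (2 * (g a).im))
  set s := (‖a‖ ^ 2 + 1) / (2 * (g a).im) with hs
  have h3 : 2 * (g a).im * s = ‖a‖ ^ 2 + 1 := by rw [hs]; field_simp
  nlinarith [sq_nonneg (g a).re, sq_nonneg (g a).im, mul_le_of_le_one_right (sq_nonneg s) hone]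

variable [PartialOrder A] [StarOrderedRing A]

/-- From `0 ≤ a ≤ ‖a‖` follows `‖‖a‖ - a‖ ≤ ‖a‖`, so `g a` lies in the disc of centre and radius
`‖a‖`, whose points have nonnegative real part. -/
theorem nonneg_apply_of_norm_le_one {g : A →L[ℂ] ℂ} (h1 : g 1 = 1) (hg : ‖g‖ ≤ 1) {a : A}
    (ha : 0 ≤ a) : 0 ≤ g a := by
  rw [Complex.nonneg_iff]
  refine ⟨?_, (im_apply_eq_zero_of_isSelfAdjoint h1 hg ha.isSelfAdjoint).symm⟩
  have hle : a ≤ algebraMap ℝ A ‖a‖ := IsSelfAdjoint.le_algebraMap_norm_self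
  have hn : ‖algebraMap ℝ A ‖a‖ - a‖ ≤ ‖a‖ :=
    (CStarAlgebra.norm_le_iff_le_algebraMap _ (norm_nonneg a) (sub_nonneg.2 hle)).2
      (sub_le_self _ ha)
  have h2 : ‖g (algebraMap ℝ A ‖a‖ - a)‖ ≤ ‖a‖ := by
    have := g.le_of_opNorm_le hg (algebraMap ℝ A ‖a‖ - a)
    rw [one_mul] at this
    exact this.trans hn
  have h3 : g (algebraMap ℝ A ‖a‖ - a) = ‖a‖ - g a := by
    rw [map_sub, Algebra.algebraMap_eq_smul_one, ← Complex.coe_smul, map_smul, h1]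
    simp
  rw [h3] at h2
  have h4 := (Complex.re_le_norm _).trans h2
  simp at h4
  linarith

/-- A unital contractive functional is a state. -/
noncomputable def stateOfNormLeOne (g : A →L[ℂ] ℂ) (h1 : g 1 = 1) (hg : ‖g‖ ≤ 1) : A →ₚ[ℂ] ℂ :=
  PositiveLinearMap.mk₀ g.toLinearMap fun _ ha => nonneg_apply_of_norm_le_one h1 hg ha

/-- The norm of a self-adjoint element is attained at a state. -/
theorem exists_state_norm_apply_eq [Nontrivial A] {h : A} (hh : IsSelfAdjoint h) :
    ∃ φ : A →ₚ[ℂ] ℂ, φ 1 = 1 ∧ ‖φ h‖ = ‖h‖ := by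
  have : IsStarNormal h := hh.isStarNormal
  -- On the commutative algebra generated by `h` some character attains `‖h‖`, by Gelfand duality
  -- and compactness. Its Hahn–Banach extension is unital and contractive, hence a state.
  let E := StarAlgebra.elemental ℂ h
  let h' : E := ⟨h, StarAlgebra.elemental.self_mem ℂ h⟩
  have : Nontrivial E := ⟨0, 1, fun e => zero_ne_one (congrArg Subtype.val e)⟩
  obtain ⟨χ, hχ⟩ : ∃ χ : WeakDual.characterSpace ℂ E, ‖h‖ ≤ ‖χ h'‖ := by
    obtain ⟨χ, -, hχ⟩ := isCompact_univ.exists_isMaxOn (Set.univ_nonempty)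
      (f := fun χ : WeakDual.characterSpace ℂ E => ‖WeakDual.gelfandTransform ℂ E h' χ‖)
      (by fun_prop)
    refine ⟨χ, ?_⟩
    have h1 : ‖WeakDual.gelfandTransform ℂ E h'‖ = ‖h‖ :=
      (AddMonoidHomClass.isometry_iff_norm _).1 (gelfandTransform_isometry E) h'
    rw [← h1]
    exact (ContinuousMap.norm_le _ (norm_nonneg _)).2 fun ψ => hχ (Set.mem_univ ψ)
  obtain ⟨g, hg, hgn⟩ := exists_extension_norm_eq E.toSubmodule
    (WeakDual.toStrongDual (χ : WeakDual ℂ E) : StrongDual ℂ E)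
  have hn : ‖g‖ ≤ 1 :=
    hgn.le.trans ((WeakDual.CharacterSpace.norm_le_norm_one χ).trans CStarRing.norm_one.le)
  have h1 : g 1 = 1 := (hg (1 : E)).trans (map_one χ)
  refine ⟨stateOfNormLeOne g h1 hn, h1, le_antisymm ?_ ?_⟩
  · exact (g.le_of_opNorm_le hn h).trans_eq (one_mul _)
  · exact hχ.trans_eq (congrArg norm (hg h').symm)

/-- Averaging a state over the orbits of an automorphism. -/
theorem exists_invariant_state (θ : A ≃⋆ₐ[ℂ] A) (φ : A →ₚ[ℂ] ℂ) (h1 : φ 1 = 1) :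
    ∃ ψ : A →ₚ[ℂ] ℂ, ψ 1 = 1 ∧ (∀ a, ψ (θ a) = ψ a) ∧ ∀ a, θ a = a → ψ a = φ a := by
  obtain ⟨C, hC⟩ := φ.exists_norm_apply_le
  have hit : ∀ (k : ℕ) (a : A), ‖φ (θ^[k] a)‖ ≤ C * ‖a‖ := fun k a => by
    refine (hC _).trans (mul_le_mul_of_nonneg_left ?_ C.2)
    induction k with
    | zero => rfl
    | succ k ih =>
      rw [Function.iterate_succ_apply']
      exact (NonUnitalStarAlgHom.norm_apply_le θ _).trans ih
  let c : ℕ → A → ℂ := fun N a => birkhoffAverage ℂ θ φ N a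
  have hcdef : ∀ N a, c N a = (N : ℂ)⁻¹ * ∑ k ∈ Finset.range N, φ (θ^[k] a) := fun N a => rfl
  have hbdd : ∀ N a, c N a ∈ Metric.closedBall (0 : ℂ) (C * ‖a‖) := fun N a => by
    rw [mem_closedBall_zero_iff, hcdef, norm_mul, norm_inv, Complex.norm_natCast]
    rcases N.eq_zero_or_pos with rfl | hN
    · simp; positivity
    · rw [inv_mul_le_iff₀ (by positivity)]
      exact (norm_sum_le _ _).trans ((Finset.sum_le_sum fun k _ => hit k a).trans_eq (by simp))
  -- Along an ultrafilter the bounded averages converge for all `a` at once, so no separability or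
  -- subsequence is needed.
  let F : Filter ℕ := hyperfilter ℕ
  have hFle : F ≤ atTop := Nat.hyperfilter_le_atTop
  have hlim : ∀ a, ∃ z, Tendsto (fun N => c N a) F (𝓝 z) := fun a => by
    obtain ⟨z, -, hz⟩ := (isCompact_closedBall (0 : ℂ) (C * ‖a‖)).ultrafilter_le_nhds
      ((hyperfilter ℕ).map fun N => c N a)
      (le_principal_iff.2 (Eventually.of_forall (f := F) fun N => hbdd N a))
    exact ⟨z, hz⟩
  choose L hL using hlim
  have hθadd : ∀ (k : ℕ) (a b : A), θ^[k] (a + b) = θ^[k] a + θ^[k] b :=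
    fun k a b => iterate_map_add θ k a b
  have hθsmul : ∀ (k : ℕ) (r : ℂ) (a : A), θ^[k] (r • a) = r • θ^[k] a := fun k r a => by
    induction k with
    | zero => rfl
    | succ k ih => rw [Function.iterate_succ_apply', ih, Function.iterate_succ_apply', map_smul]
  have hθnonneg : ∀ (k : ℕ) (a : A), 0 ≤ a → 0 ≤ θ^[k] a := fun k a ha => by
    induction k with
    | zero => exact ha
    | succ k ih => rw [Function.iterate_succ_apply']; exact map_nonneg θ ih
  have hcadd : ∀ N a b, c N (a + b) = c N a + c N b := fun N a b => by
    simp only [hcdef, hθadd, map_add, Finset.sum_add_distrib, mul_add]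
  have hcsmul : ∀ N (r : ℂ) a, c N (r • a) = r * c N a := fun N r a => by
    simp only [hcdef, hθsmul, map_smul, smul_eq_mul, ← Finset.mul_sum]; ring
  have hcnonneg : ∀ N a, 0 ≤ a → 0 ≤ c N a := fun N a ha => by
    rw [hcdef]
    refine mul_nonneg ?_ (Finset.sum_nonneg fun k _ => map_nonneg φ (hθnonneg k a ha))
    rw [inv_nonneg]; exact Nat.cast_nonneg N
  have hfix : ∀ a, θ a = a → L a = φ a := fun a ha =>
    tendsto_nhds_unique (hL a) ((Function.IsFixedPt.tendsto_birkhoffAverage ℂ ha φ).mono_left hFle)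
  let ψ : A →ₗ[ℂ] ℂ :=
    { toFun := L
      map_add' := fun a b => tendsto_nhds_unique (hL (a + b))
        (((hL a).add (hL b)).congr fun N => (hcadd N a b).symm)
      map_smul' := fun r a => tendsto_nhds_unique (hL (r • a))
        (((hL a).const_mul r).congr fun N => (hcsmul N r a).symm) }
  refine ⟨PositiveLinearMap.mk₀ ψ fun a ha => ge_of_tendsto' (hL a) fun N => hcnonneg N a ha,
    (hfix 1 (map_one θ)).trans h1, fun a => ?_, hfix⟩
  -- The difference telescopes to two bounded terms divided by `N`.
  have h0 : Tendsto (fun N => c N (θ a) - c N a) F (𝓝 0) :=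
    (tendsto_birkhoffAverage_apply_sub_birkhoffAverage ℂ
      (Metric.isBounded_iff_subset_closedBall 0 |>.2 ⟨C * ‖a‖, by
        rintro _ ⟨k, rfl⟩
        exact mem_closedBall_zero_iff.2 (hit k a)⟩)).mono_left hFle
  exact sub_eq_zero.1 (tendsto_nhds_unique ((hL (θ a)).sub (hL a)) h0)

/-- The self-adjoint fixed points of a uniquely ergodic automorphism are scalars. -/
theorem IsUniquelyErgodic.eq_smul_one {θ : A ≃⋆ₐ[ℂ] A} {ω : A →ₚ[ℂ] ℂ}
    (hω : IsUniquelyErgodic θ ω) {h : A} (hh : IsSelfAdjoint h) (hθ : θ h = h) :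
    h = ω h • (1 : A) := by
  have : Nontrivial A := ⟨1, 0, fun e => by
    have := hω.map_one
    rw [e, map_zero] at this
    exact zero_ne_one this⟩
  have hreal : IsSelfAdjoint (ω h) := by
    rw [isSelfAdjoint_iff, ← map_star, hh.star_eq]
  have hk : IsSelfAdjoint (h - ω h • (1 : A)) := hh.sub (hreal.smul (IsSelfAdjoint.one A))
  -- Averaging a norming state `φ` keeps its value at the fixed element `h - ω(h) 1` but yields `ω`,
  -- which vanishes there.
  obtain ⟨φ, h1, hφ⟩ := exists_state_norm_apply_eq hk
  obtain ⟨ψ, hψ1, hψ, hfix⟩ := exists_invariant_state θ φ h1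
  have hψω := hω.unique ψ hψ1 hψ
  rw [← hfix _ (by rw [map_sub, map_smul, _root_.map_one, hθ]), hψω, map_sub, map_smul,
    hω.map_one,
    smul_eq_mul, mul_one, sub_self, norm_zero] at hφ
  exact sub_eq_zero.1 (norm_eq_zero.1 hφ.symm)

end States

/-! ### The regular representation on `ℓ²(ℤ, H)` -/

section RegularRepresentation

variable {H : Type*} [NormedAddCommGroup H] [InnerProductSpace ℂ H]

/-- The bilateral shift of `ℓ²(ℤ, H)`. -/
noncomputable def bilateralShift (H : Type*) [NormedAddCommGroup H] [InnerProductSpace ℂ H]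
    (k : ℤ) : lp (fun _ : ℤ => H) 2 →ₗᵢ[ℂ] lp (fun _ : ℤ => H) 2 where
  toFun f := ⟨fun m => f (m - k), memℓp_gen
    (((Equiv.subRight k).summable_iff (f := fun m => ‖f m‖ ^ (2 : ENNReal).toReal)).2
      ((lp.memℓp f).summable (by norm_num)))⟩
  map_add' _ _ := rfl
  map_smul' _ _ := rfl
  norm_map' f := by
    rw [lp.norm_eq_tsum_rpow (by norm_num), lp.norm_eq_tsum_rpow (by norm_num) f]
    congr 1
    exact (Equiv.subRight k).tsum_eq (fun m => ‖f m‖ ^ (2 : ENNReal).toReal)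

theorem bilateralShift_apply (k m : ℤ) (f : lp (fun _ : ℤ => H) 2) :
    bilateralShift H k f m = f (m - k) := rfl

/-- The bilateral shift by one step as an isometric isomorphism. -/
noncomputable def bilateralShiftEquiv (H : Type*) [NormedAddCommGroup H] [InnerProductSpace ℂ H] :
    lp (fun _ : ℤ => H) 2 ≃ₗᵢ[ℂ] lp (fun _ : ℤ => H) 2 :=
  LinearIsometryEquiv.ofSurjective (bilateralShift H 1) fun f =>
    ⟨bilateralShift H (-1) f, lp.ext (funext fun m => by
      rw [bilateralShift_apply, bilateralShift_apply]
      exact congrArg (fun j => f j) (by ring : m - 1 - -1 = m))⟩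

theorem norm_apply_single_le (T : lp (fun _ : ℤ => H) 2 →L[ℂ] lp (fun _ : ℤ => H) 2) {ξ : H}
    (hξ : ‖ξ‖ = 1) (n : ℤ) : ‖T (lp.single 2 0 ξ) n‖ ≤ ‖T‖ := by
  have h1 := lp.norm_apply_le_norm (p := 2) (by norm_num) (T (lp.single 2 0 ξ)) n
  have h2 := T.le_opNorm (lp.single 2 0 ξ)
  rw [lp.norm_single (by norm_num), hξ, mul_one] at h2
  exact h1.trans h2

variable [CompleteSpace H]

/-- The bilateral shift by one step as a unitary operator. -/
noncomputable def shiftUnitary (H : Type*) [NormedAddCommGroup H] [InnerProductSpace ℂ H]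
    [CompleteSpace H] : unitary (lp (fun _ : ℤ => H) 2 →L[ℂ] lp (fun _ : ℤ => H) 2) :=
  Unitary.linearIsometryEquiv.symm (bilateralShiftEquiv H)

theorem shiftUnitary_apply (f : lp (fun _ : ℤ => H) 2) (m : ℤ) :
    (shiftUnitary H : lp (fun _ : ℤ => H) 2 →L[ℂ] lp (fun _ : ℤ => H) 2) f m = f (m - 1) := rfl

theorem shiftUnitary_zpow_apply (k : ℤ) (f : lp (fun _ : ℤ => H) 2) (m : ℤ) :
    ((shiftUnitary H ^ k : unitary (lp (fun _ : ℤ => H) 2 →L[ℂ] lp (fun _ : ℤ => H) 2)) :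
      lp (fun _ : ℤ => H) 2 →L[ℂ] lp (fun _ : ℤ => H) 2) f m = f (m - k) := by
  induction k generalizing f m with
  | zero => simp
  | succ k ih =>
    rw [zpow_add_one, Submonoid.coe_mul, mul_apply_eq_comp, ih, shiftUnitary_apply]
    exact congrArg (fun j => f j) (by ring : m - k - 1 = m - (k + 1))
  | pred k ih =>
    rw [zpow_sub_one, Submonoid.coe_mul, mul_apply_eq_comp, ih]
    -- The inverse shift has no explicit formula here: apply the shift to `g f` and evaluate at `m +
    -- k + 1`.
    set g := ((shiftUnitary H)⁻¹ : unitary (lp (fun _ : ℤ => H) 2 →L[ℂ] lp (fun _ : ℤ => H) 2)) with hg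
    have h1 : (shiftUnitary H : lp (fun _ : ℤ => H) 2 →L[ℂ] lp (fun _ : ℤ => H) 2)
        ((g : lp (fun _ : ℤ => H) 2 →L[ℂ] lp (fun _ : ℤ => H) 2) f) = f := by
      rw [← mul_apply_eq_comp, ← Submonoid.coe_mul, hg, mul_inv_cancel]
      rfl
    have h2 := shiftUnitary_apply
      ((g : lp (fun _ : ℤ => H) 2 →L[ℂ] lp (fun _ : ℤ => H) 2) f) (m + k + 1)
    rw [h1] at h2
    refine Eq.trans ?_ (h2.symm.trans ?_)
    · exact congrArg (fun j => (g : lp (fun _ : ℤ => H) 2 →L[ℂ] lp (fun _ : ℤ => H) 2) f j)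
        (by ring : m - -(k : ℤ) = m + k + 1 - 1)
    · exact congrArg (fun j => f j) (by ring : m + k + 1 = m - (-(k : ℤ) - 1))

variable {A : Type*} [CStarAlgebra A] (α : A ≃⋆ₐ[ℂ] A) (π : A →⋆ₐ[ℂ] (H →L[ℂ] H))

theorem norm_repr_zpow_le (a : A) (m : ℤ) : ‖π ((α ^ (-m)) a)‖ ≤ ‖a‖ :=
  (NonUnitalStarAlgHom.norm_apply_le π _).trans (NonUnitalStarAlgHom.norm_apply_le (α ^ (-m)) _)

/-- The diagonal representation `(ρ(a) f)(m) = π(α⁻ᵐ(a)) f(m)` on `ℓ²(ℤ, H)`. -/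
noncomputable def diagonalRepr :
    A →⋆ₐ[ℂ] (lp (fun _ : ℤ => H) 2 →L[ℂ] lp (fun _ : ℤ => H) 2) where
  toFun a := lp.mapCLM 2 (fun m : ℤ => π ((α ^ (-m)) a)) (norm_nonneg a) (norm_repr_zpow_le α π a)
  map_one' := by ext f m : 3; simp
  map_mul' a b := by ext f m : 3; simp
  map_zero' := by ext f m : 3; simp
  map_add' a b := by ext f m : 3; simp
  commutes' c := by
    ext f m : 3
    simp [Algebra.algebraMap_eq_smul_one]
  map_star' a := by
    rw [ContinuousLinearMap.star_eq_adjoint, ContinuousLinearMap.eq_adjoint_iff]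
    intro f g
    rw [lp.inner_eq_tsum, lp.inner_eq_tsum]
    refine tsum_congr fun m => ?_
    simp only [lp.mapCLM_apply_coe]
    rw [map_star, map_star, ContinuousLinearMap.star_eq_adjoint,
      ContinuousLinearMap.adjoint_inner_left]

theorem diagonalRepr_apply (a : A) (f : lp (fun _ : ℤ => H) 2) (m : ℤ) :
    diagonalRepr α π a f m = π ((α ^ (-m)) a) (f m) := rfl

theorem shiftUnitary_mul_diagonalRepr (a : A) :
    (shiftUnitary H : lp (fun _ : ℤ => H) 2 →L[ℂ] lp (fun _ : ℤ => H) 2) * diagonalRepr α π a =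
      diagonalRepr α π (α a) * shiftUnitary H := by
  ext f m : 3
  rw [mul_apply_eq_comp, mul_apply_eq_comp, shiftUnitary_apply,
    diagonalRepr_apply, diagonalRepr_apply, shiftUnitary_apply]
  -- Covariance is the identity `α⁻ᵐ α = α^{-(m-1)}`; it dictates the exponent `-m` on the diagonal.
  have := FiniteSums.zpow_zpow_apply α (-m) 1 a
  rw [zpow_one] at this
  rw [this, show -(m - 1) = -m + 1 by ring]

/-- The regular representation of the finite sums on `ℓ²(ℤ, H)`. -/
noncomputable def regularRepr :
    FiniteSums α →⋆ₐ[ℂ] (lp (fun _ : ℤ => H) 2 →L[ℂ] lp (fun _ : ℤ => H) 2) :=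
  FiniteSums.lift α (diagonalRepr α π) (shiftUnitary H) (shiftUnitary_mul_diagonalRepr α π)

end RegularRepresentation

/-- The norm of a C⋆-algebra as a C⋆-seminorm. -/
noncomputable def CStarSeminorm.ofNorm (R : Type*) [CStarAlgebra R] : CStarSeminorm R where
  toSeminorm := normSeminorm ℂ R
  mul_le' := norm_mul_le
  star_mul_self' _ := CStarRing.norm_star_mul_self

theorem norm_gns_sq {A : Type*} [CStarAlgebra A] [PartialOrder A] [StarOrderedRing A]
    (ω : A →ₚ[ℂ] ℂ) (a : A) : ‖(ω.toPreGNS a : ω.GNS)‖ ^ 2 = ‖ω (star a * a)‖ := by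
  rw [UniformSpace.Completion.norm_coe]
  have := congrArg norm (ω.preGNS_norm_sq (ω.toPreGNS a))
  rw [norm_pow, Complex.norm_real, norm_norm] at this
  exact this

/-! ### Coefficients of finite sums and of crossed-product elements -/

namespace FiniteSums

variable {A : Type*} [CStarAlgebra A] (α : A ≃⋆ₐ[ℂ] A)

theorem norm_le_maxSeminorm {R : Type*} [CStarAlgebra R] (f : FiniteSums α →⋆ₐ[ℂ] R)
    (x : FiniteSums α) : ‖f x‖ ≤ maxSeminorm α x :=
  le_maxSeminorm α ((CStarSeminorm.ofNorm R).comap f) x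

/-- The linear map `∑ₖ Vᵏ bₖ ↦ bₙ`. -/
noncomputable def coefficient (n : ℤ) : FiniteSums α →ₗ[ℂ] A where
  -- Finite sums are stored as `∑ aₙ Vⁿ`, and `aₙ Vⁿ = Vⁿ α⁻ⁿ(aₙ)`.
  toFun x := (α ^ (-n)) (SkewMonoidAlgebra.coeff x (Multiplicative.ofAdd n))
  map_add' x y := (congrArg (α ^ (-n)) (DFunLike.congr_fun (SkewMonoidAlgebra.coeff_add x y)
    (Multiplicative.ofAdd n))).trans (map_add (α ^ (-n)) _ _)
  map_smul' c x := (congrArg (α ^ (-n)) (DFunLike.congr_fun (SkewMonoidAlgebra.coeff_smul c x)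
    (Multiplicative.ofAdd n))).trans (_root_.map_smul (α ^ (-n)) _ _)

theorem coefficient_mon (n k : ℤ) (a : A) :
    coefficient α n (mon α k a) = if k = n then (α ^ (-n)) a else 0 := by
  change (α ^ (-n)) ((SkewMonoidAlgebra.single (Multiplicative.ofAdd k) a).coeff _) = _
  rw [SkewMonoidAlgebra.coeff_single_apply]
  by_cases h : k = n
  · simp [h]
  · simp [h]

/-- `Vᵏ b` acts at site `0` by `π(b)` and then moves the vector to site `k`, so the coefficients can
be read off one column. -/
theorem regularRepr_single_apply {H : Type*} [NormedAddCommGroup H] [InnerProductSpace ℂ H]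
    [CompleteSpace H] (π : A →⋆ₐ[ℂ] (H →L[ℂ] H)) (x : FiniteSums α) (ξ : H) (n : ℤ) :
    regularRepr α π x (lp.single 2 0 ξ) n = π (coefficient α n x) ξ := by
  induction x using induction with
  | ha x y hx hy =>
    rw [map_add, map_add, map_add, _root_.add_apply, _root_.add_apply,
      lp.coeFn_add, Pi.add_apply, hx, hy]
  | hm k a =>
    rw [regularRepr, lift_mon, mul_apply_eq_comp, diagonalRepr_apply,
      shiftUnitary_zpow_apply, coefficient_mon]
    by_cases h : k = n
    · subst h
      rw [if_pos rfl, sub_self, lp.single_apply_self]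
    · rw [if_neg h, lp.single_apply_ne _ _ _ (sub_ne_zero.2 (Ne.symm h))]
      simp

/-- A state attaining `‖d⋆ d‖` has a unit GNS vector `ξ` with `‖π(d) ξ‖ = ‖d‖`. That vector is one
entry of the regular representation applied to `x`, whose norm the maximal seminorm dominates. -/
theorem norm_coefficient_le (n : ℤ) (x : FiniteSums α) :
    ‖coefficient α n x‖ ≤ maxSeminorm α x := by
  rcases subsingleton_or_nontrivial A with hA | hA
  · rw [Subsingleton.elim (coefficient α n x) 0, norm_zero]
    exact (maxSeminorm α).nonneg x
  let := CStarAlgebra.spectralOrder A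
  have := CStarAlgebra.spectralOrderedRing A
  set d := coefficient α n x
  obtain ⟨φ, h1, hφ⟩ := exists_state_norm_apply_eq (IsSelfAdjoint.star_mul_self d)
  have hξ : ‖gnsVector φ‖ = 1 := by
    have := norm_gns_sq φ 1
    rw [star_one, one_mul, h1, norm_one] at this
    exact (pow_eq_one_iff_of_nonneg (norm_nonneg _) two_ne_zero).1 this
  have hd : ‖φ.gnsStarAlgHom d (gnsVector φ)‖ = ‖d‖ := by
    rw [gnsStarAlgHom_gnsVector, ← sq_eq_sq₀ (norm_nonneg _) (norm_nonneg _), norm_gns_sq, hφ,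
      CStarRing.norm_star_mul_self, sq]
  calc ‖d‖ = ‖regularRepr α φ.gnsStarAlgHom x (lp.single 2 0 (gnsVector φ)) n‖ := by
        rw [regularRepr_single_apply, hd]
    _ ≤ ‖regularRepr α φ.gnsStarAlgHom x‖ := norm_apply_single_le _ hξ n
    _ ≤ maxSeminorm α x := norm_le_maxSeminorm α _ x

end FiniteSums

namespace CrossedProduct

variable {A : Type*} [CStarAlgebra A] (α : A ≃⋆ₐ[ℂ] A)

/-- The canonical map of the finite sums into the crossed product. -/
noncomputable def ofFiniteSums : FiniteSums α →⋆ₐ[ℂ] CrossedProduct α :=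
  (FiniteSums.maxSeminorm α).toEnveloping

theorem denseRange_ofFiniteSums : DenseRange (ofFiniteSums α) :=
  UniformSpace.Completion.denseRange_coe (α := (FiniteSums.maxSeminorm α).Carrier)

/-- The bounded linear map `∑ₖ Vᵏ bₖ ↦ bₙ` on the crossed product. -/
noncomputable def coefficient (n : ℤ) : CrossedProduct α →L[ℂ] A :=
  (FiniteSums.coefficient α n).extendOfNorm (ofFiniteSums α).toAlgHom.toLinearMap

theorem coefficient_ofFiniteSums (n : ℤ) (x : FiniteSums α) :
    coefficient α n (ofFiniteSums α x) = FiniteSums.coefficient α n x :=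
  LinearMap.extendOfNorm_eq (denseRange_ofFiniteSums α) ⟨1, fun x => by
    rw [one_mul]
    exact (FiniteSums.norm_coefficient_le α n x).trans_eq
      ((FiniteSums.maxSeminorm α).norm_toEnveloping x).symm⟩ x

end CrossedProduct

theorem continuous_starAlgEquiv {A : Type*} [CStarAlgebra A] (θ : A ≃⋆ₐ[ℂ] A) : Continuous θ :=
  AddMonoidHomClass.continuous_of_bound θ 1 fun a => by
    rw [one_mul]
    exact NonUnitalStarAlgHom.norm_apply_le θ a

/-! ### The skew product seen on coefficients -/

section SkewProduct

variable {A : Type*} [CStarAlgebra A] (θ α : A ≃⋆ₐ[ℂ] A) (u : unitary A)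

theorem twistedGen_eq_mon : (twistedGen α u : FiniteSums α) = FiniteSums.mon α 1 u := by
  change FiniteSums.mon α 0 (u : A) * FiniteSums.mon α 1 1 = _
  rw [FiniteSums.mon_mul_mon]
  simp

theorem twistedGen_inv_eq_mon :
    ((twistedGen α u)⁻¹ : unitary (FiniteSums α)) =
      FiniteSums.mon α (-1) ((α ^ (-1 : ℤ)) (star (u : A))) := by
  change star (twistedGen α u : FiniteSums α) = _
  rw [twistedGen_eq_mon, FiniteSums.star_mon]

/-- The defining relation `(u V)ⁿ = u_n Vⁿ`. -/
theorem twistedGen_zpow (n : ℤ) :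
    ((twistedGen α u ^ n : unitary (FiniteSums α)) : FiniteSums α) =
      FiniteSums.mon α n (skewCocycle α u n) := by
  have hpos : ∀ n : ℕ, ((twistedGen α u ^ (n : ℤ) : unitary (FiniteSums α)) : FiniteSums α) =
      FiniteSums.mon α n ((List.range n).map fun k => (α ^ k) (u : A)).prod := fun n => by
    induction n with
    | zero => simp [FiniteSums.mon_one]
    | succ n ih =>
      rw [Nat.cast_succ, zpow_add_one, Submonoid.coe_mul, ih, twistedGen_eq_mon,
        FiniteSums.mon_mul_mon, List.range_succ, List.map_append, List.prod_append, zpow_natCast]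
      simp
  have hneg : ∀ n : ℕ, ((twistedGen α u ^ (-n : ℤ) : unitary (FiniteSums α)) : FiniteSums α) =
      FiniteSums.mon α (-n)
        ((List.range n).map fun k : ℕ => (α ^ (-((k : ℤ) + 1))) (star (u : A))).prod := fun n => by
    induction n with
    | zero => simp [FiniteSums.mon_one]
    | succ n ih =>
      rw [Nat.cast_succ, neg_add, ← sub_eq_add_neg, zpow_sub_one, Submonoid.coe_mul, ih,
        twistedGen_inv_eq_mon, FiniteSums.mon_mul_mon, List.range_succ, List.map_append,
        List.prod_append, FiniteSums.zpow_zpow_apply, sub_eq_add_neg, List.map_singleton,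
        List.prod_singleton, neg_add (n : ℤ) 1]
  cases n with
  | ofNat n => exact hpos n
  | negSucc n =>
    -- `Int.negSucc n` is `-(n + 1)`. In `skewCocycle` the list of naturals is coerced to integers
    -- through the list monad, which the simplification unfolds into a map.
    refine (hneg (n + 1)).trans (congrArg (FiniteSums.mon α (Int.negSucc n)) ?_)
    simp only [skewCocycle, List.pure_def, List.bind_eq_flatMap, ← List.map_eq_flatMap,
      List.map_map]
    rfl

namespace FiniteSums

theorem mon_injective (n : ℤ) : Function.Injective (mon α n) := fun a b h => by
  have := congrArg (coefficient α n) h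
  rw [coefficient_mon, coefficient_mon, if_pos rfl, if_pos rfl] at this
  exact (α ^ (-n)).injective this

end FiniteSums

/-- Degree-`0` part of `((u V)ⁿ)⋆ (u V)ⁿ = 1`. It makes `π_ω(α⁻ⁿ(u_n)) V_{ω,θ}` isometric. -/
theorem star_mul_self_skewCocycle (n : ℤ) :
    star ((α ^ (-n)) (skewCocycle α u n)) *
      (α ^ (-n)) (skewCocycle α u n) = 1 := by
  have h := (twistedGen α u ^ n).2.1
  rw [twistedGen_zpow, FiniteSums.star_mon, FiniteSums.mon_mul_mon, neg_add_cancel,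
    ← FiniteSums.mon_one] at h
  rw [← map_star]
  exact FiniteSums.mon_injective α 0 h

variable (hu : ∀ a, (u : A) * α (θ a) = θ (α a) * u)

include hu in
-- Compare degree-`n` terms in `(u V)ⁿ θ(a) = θ(αⁿ(a)) (u V)ⁿ`.
theorem mul_skewCocycle (n : ℤ) (a : A) :
    θ ((α ^ n) a) * skewCocycle α u n =
      skewCocycle α u n * (α ^ n) (θ a) := by
  have h := FiniteSums.zpow_mul_eq α ((FiniteSums.incl α).comp (θ : A →⋆ₐ[ℂ] A)) (twistedGen α u)
    (twistedGen_mul θ α u hu) n a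
  rw [twistedGen_zpow] at h
  change FiniteSums.mon α n _ * FiniteSums.mon α 0 (θ a) =
    FiniteSums.mon α 0 (θ ((α ^ n) a)) * FiniteSums.mon α n _ at h
  rw [FiniteSums.mon_mul_mon, FiniteSums.mon_mul_mon, add_zero, zero_add, zpow_zero] at h
  exact (FiniteSums.mon_injective α n h).symm

/-- The skew product preserves degree: `Vⁿ b ↦ (u V)ⁿ θ(b) = Vⁿ α⁻ⁿ(u_n) θ(b)`. This is the origin
of the twist `α⁻ⁿ(u_n)`. -/
theorem coefficient_skewProductFinite (n : ℤ) (x : FiniteSums α) :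
    FiniteSums.coefficient α n (skewProductFinite θ α u hu x) =
      (α ^ (-n)) (skewCocycle α u n) * θ (FiniteSums.coefficient α n x) := by
  induction x using FiniteSums.induction with
  | ha x y hx hy => rw [map_add, map_add, map_add, map_add, mul_add, hx, hy]
  | hm k a =>
    rw [skewProductFinite, FiniteSums.lift_mon, twistedGen_zpow]
    change FiniteSums.coefficient α n (FiniteSums.mon α 0 (θ a) * FiniteSums.mon α k _) = _
    rw [FiniteSums.mon_mul_mon, FiniteSums.coefficient_mon, FiniteSums.coefficient_mon, zero_add]
    by_cases h : k = n
    · subst h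
      have h1 := mul_skewCocycle θ α u hu k ((α ^ (-k)) a)
      rw [FiniteSums.zpow_zpow_apply, add_neg_cancel, zpow_zero] at h1
      have h2 := congrArg (α ^ (-k)) h1
      rw [map_mul (α ^ (-k)) (skewCocycle α u k), FiniteSums.zpow_zpow_apply,
        neg_add_cancel, zpow_zero] at h2
      rw [if_pos rfl, if_pos rfl]
      exact h2
    · rw [if_neg h, if_neg h, map_zero, mul_zero]

theorem coefficient_skewProduct (n : ℤ) (x : CrossedProduct α) :
    CrossedProduct.coefficient α n (skewProduct θ α u hu x) =
      (α ^ (-n)) (skewCocycle α u n) * θ (CrossedProduct.coefficient α n x) := by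
  have hθ : Continuous θ := continuous_starAlgEquiv θ
  have hΦ : Continuous (skewProduct θ α u hu) :=
    UniformSpace.Completion.continuous_map
  refine (CrossedProduct.denseRange_ofFiniteSums α).induction_on x ?_ fun y => ?_
  · exact isClosed_eq (by fun_prop) (by fun_prop)
  · have : skewProduct θ α u hu (CrossedProduct.ofFiniteSums α y) =
        CrossedProduct.ofFiniteSums α (skewProductFinite θ α u hu y) :=
      (FiniteSums.maxSeminorm α).extend_toEnveloping _ _ _
    rw [this, CrossedProduct.coefficient_ofFiniteSums, CrossedProduct.coefficient_ofFiniteSums,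
      coefficient_skewProductFinite]

theorem coefficient_surjective (n : ℤ) :
    Function.Surjective (CrossedProduct.coefficient α n) := fun a =>
  ⟨CrossedProduct.ofFiniteSums α (FiniteSums.mon α n ((α ^ n) a)), by
    rw [CrossedProduct.coefficient_ofFiniteSums, FiniteSums.coefficient_mon, if_pos rfl,
      FiniteSums.zpow_zpow_apply, neg_add_cancel, zpow_zero]
    rfl⟩

end SkewProduct

/-! ### Fixed points and coboundaries -/

/-- Unique ergodicity relative to the fixed points makes the sum of the fixed points and of the
coboundaries dense. -/
theorem IsUniquelyErgodicRelFixed.exists_norm_sub_lt {B : Type*} [CStarAlgebra B] {Φ : B →⋆ₐ[ℂ] B}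
    (hΦ : IsUniquelyErgodicRelFixed Φ) (b : B) {ε : ℝ} (hε : 0 < ε) :
    ∃ x y : B, Φ x = x ∧ ‖b - (x + (y - Φ y))‖ < ε := by
  let D : B →ₗ[ℂ] B := LinearMap.id - Φ.toAlgHom.toLinearMap
  have hD : ∀ y, D y = y - Φ y := fun _ => rfl
  let M : Submodule ℂ B := (LinearMap.ker D ⊔ LinearMap.range D).topologicalClosure
  have hb : b ∈ M := by
    -- Otherwise Hahn–Banach gives `g ≠ 0` vanishing on fixed points and coboundaries. Then `g` and
    -- `0` are both invariant extensions of the zero functional, against uniqueness.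
    by_contra hb
    have : IsClosed (M : Set B) := Submodule.isClosed_topologicalClosure _
    obtain ⟨f, hf⟩ := SeparatingDual.exists_ne_zero (R := ℂ)
      (x := (Submodule.Quotient.mk b : B ⧸ M)) (by rwa [Ne, Submodule.Quotient.mk_eq_zero])
    let g : B →L[ℂ] ℂ := f.comp M.mkQL
    have hg : ∀ z ∈ LinearMap.ker D ⊔ LinearMap.range D, g z = 0 := fun z hz => by
      change f (Submodule.Quotient.mk z) = 0
      rw [(Submodule.Quotient.mk_eq_zero M).2 (Submodule.le_topologicalClosure _ hz), map_zero]
    obtain ⟨g₀, -, huniq⟩ := hΦ 0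
    have h1 : g = g₀ := huniq g ⟨fun y => by
        have := hg (D y) (Submodule.mem_sup_right ⟨y, rfl⟩)
        rw [hD, map_sub, sub_eq_zero] at this
        exact this.symm, fun x => hg _ (Submodule.mem_sup_left (by
          rw [LinearMap.mem_ker, hD, sub_eq_zero]; exact x.2.symm))⟩
    have h2 : (0 : B →L[ℂ] ℂ) = g₀ := huniq 0 ⟨fun _ => rfl, fun _ => rfl⟩
    exact hf (by change g b = 0; rw [h1, ← h2]; rfl)
  obtain ⟨z, hz, hbz⟩ := Metric.mem_closure_iff.1 hb ε hε
  obtain ⟨x, hx, -, ⟨y, rfl⟩, rfl⟩ := Submodule.mem_sup.1 hz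
  rw [LinearMap.mem_ker, hD, sub_eq_zero] at hx
  exact ⟨x, y, hx.symm, by rwa [dist_eq_norm] at hbz⟩

/-- For an isometry, fixed vectors are orthogonal to coboundaries, so Pythagoras applies. -/
theorem norm_le_norm_add_sub_map {H : Type*} [NormedAddCommGroup H] [InnerProductSpace ℂ H]
    (U : H →ₗᵢ[ℂ] H) {z : H} (hz : U z = z) (v : H) : ‖z‖ ≤ ‖z + (v - U v)‖ := by
  have h : inner ℂ z (v - U v) = 0 := by
    have := U.inner_map_map z v
    rw [hz] at this
    rw [inner_sub_right, this, sub_self]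
  have h2 := norm_add_sq_eq_norm_sq_add_norm_sq_of_inner_eq_zero z (v - U v) h
  nlinarith [norm_nonneg z, norm_nonneg (z + (v - U v)), mul_self_nonneg ‖v - U v‖]

/-! ### Fixed points of `a ↦ w θ(a)` in the GNS space -/

section TwistedFixedPoints

variable {A : Type*} [CStarAlgebra A] [PartialOrder A] [StarOrderedRing A]
  (θ : A ≃⋆ₐ[ℂ] A) (ω : A →ₚ[ℂ] ℂ)

/-- The operator `π_ω(w) V_{ω,θ}` for an isometry `w`. -/
noncomputable def twistedCovariantIsometry (h : ∀ a, ω (θ a) = ω a) {w : A}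
    (hw : star w * w = 1) : ω.GNS →ₗᵢ[ℂ] ω.GNS where
  toLinearMap := (ω.gnsStarAlgHom w * covariantUnitary θ ω h : ω.GNS →L[ℂ] ω.GNS).toLinearMap
  norm_map' v := by
    change ‖ω.gnsStarAlgHom w (covariantUnitary θ ω h v)‖ = ‖v‖
    induction v using UniformSpace.Completion.induction_on with
    | hp => exact isClosed_eq (by fun_prop) (by fun_prop)
    | ih v =>
      have h1 : (v : ω.GNS) = ω.gnsStarAlgHom (ω.ofPreGNS v) (gnsVector ω) :=
        (gnsStarAlgHom_gnsVector ω _).symm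
      rw [h1, covariantUnitary_gns, ← mul_apply_eq_comp, ← map_mul, gnsStarAlgHom_gnsVector,
        gnsStarAlgHom_gnsVector, ← sq_eq_sq₀ (norm_nonneg _) (norm_nonneg _), norm_gns_sq,
        norm_gns_sq, star_mul, mul_assoc, ← mul_assoc (star w), hw, one_mul, ← map_star, ← map_mul,
        h]

theorem twistedCovariantIsometry_gns (h : ∀ a, ω (θ a) = ω a) {w : A} (hw : star w * w = 1)
    (a : A) : twistedCovariantIsometry θ ω h hw (ω.gnsStarAlgHom a (gnsVector ω)) =
      ω.gnsStarAlgHom (w * θ a) (gnsVector ω) := by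
  change ω.gnsStarAlgHom w (covariantUnitary θ ω h _) = _
  rw [covariantUnitary_gns, ← mul_apply_eq_comp, ← map_mul]

/-- The fixed points of `a ↦ w θ(a)`. -/
def twistedFixedPoints (w : A) : Submodule ℂ A where
  carrier := {a | w * θ a = a}
  add_mem' {a b} ha hb := by
    change w * θ (a + b) = a + b
    rw [map_add, mul_add, ha, hb]
  zero_mem' := by
    change w * θ 0 = 0
    rw [map_zero, mul_zero]
  smul_mem' c a ha := by
    change w * θ (c • a) = c • a
    rw [map_smul, mul_smul_comm, ha]

theorem isClosed_twistedFixedPoints (w : A) : IsClosed (twistedFixedPoints θ w : Set A) := by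
  have hθ : Continuous θ := continuous_starAlgEquiv θ
  exact isClosed_eq (by fun_prop) continuous_id

variable {θ ω}

/-- If `θ` is uniquely ergodic, then `a ↦ π_ω(a) ξ_ω` is isometric on the fixed points of
`a ↦ w θ(a)`. -/
theorem IsUniquelyErgodic.norm_gns_eq (hω : IsUniquelyErgodic θ ω) {w : A} (hw : star w * w = 1)
    {a : A} (ha : w * θ a = a) : ‖ω.gnsStarAlgHom a (gnsVector ω)‖ = ‖a‖ := by
  -- As `w⋆ w = 1`, `a⋆ a = (w θ(a))⋆ (w θ(a)) = θ(a⋆ a)`.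
  have hθ : θ (star a * a) = star a * a := by
    conv_rhs => rw [← ha]
    rw [star_mul, mul_assoc, ← mul_assoc (star w), hw, one_mul, map_mul, map_star]
  have h := hω.eq_smul_one (IsSelfAdjoint.star_mul_self a) hθ
  have : Nontrivial A := ⟨1, 0, fun e => by
    have := hω.map_one
    rw [e, map_zero] at this
    exact zero_ne_one this⟩
  rw [gnsStarAlgHom_gnsVector, ← sq_eq_sq₀ (norm_nonneg _) (norm_nonneg _), norm_gns_sq, sq ‖a‖,
    ← CStarRing.norm_star_mul_self]
  conv_rhs => rw [h, norm_smul, norm_one, mul_one]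

/-- An isometric image of a complete space is closed. -/
theorem IsUniquelyErgodic.isClosed_range_gns (hω : IsUniquelyErgodic θ ω) {w : A}
    (hw : star w * w = 1) :
    IsClosed ((fun a => ω.gnsStarAlgHom a (gnsVector ω)) '' (twistedFixedPoints θ w : Set A)) := by
  let J : twistedFixedPoints θ w →ₗᵢ[ℂ] ω.GNS :=
    { toFun := fun a => ω.gnsStarAlgHom (a : A) (gnsVector ω)
      map_add' := fun a b => by
        rw [Submodule.coe_add, map_add]; rfl
      map_smul' := fun c a => by
        rw [Submodule.coe_smul, map_smul]; rfl
      norm_map' := fun a => hω.norm_gns_eq hw a.2 }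
  have : CompleteSpace (twistedFixedPoints θ w) :=
    (isClosed_twistedFixedPoints θ w).completeSpace_coe
  rw [Set.image_eq_range]
  exact J.isometry.isClosedEmbedding.isClosed_range

end TwistedFixedPoints

/-! ### The main theorem -/

theorem mainTheorem6 {A : Type*} [CStarAlgebra A] [PartialOrder A] [StarOrderedRing A]
    (θ α : A ≃⋆ₐ[ℂ] A) (u : unitary A)
    (hu : ∀ a : A, (u : A) * α (θ a) = θ (α a) * (u : A))
    (ω : A →ₚ[ℂ] ℂ) (hω : IsUniquelyErgodic θ ω)
    (hΦ : IsUniquelyErgodicRelFixed (skewProduct θ α u hu))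
    (n : ℤ) (η : ω.GNS)
    (hη : ω.gnsStarAlgHom ((α ^ (-n)) (skewCocycle α u n)) (covariantUnitary θ ω hω.invariant η)
      = η) :
    ∃ a : A, (α ^ (-n)) (skewCocycle α u n) * θ a = a ∧
      η = ω.gnsStarAlgHom a (gnsVector ω) := by
  set w := (α ^ (-n)) (skewCocycle α u n)
  have hw : star w * w = 1 := star_mul_self_skewCocycle α u n
  let U := twistedCovariantIsometry θ ω hω.invariant hw
  have hUη : U η = η := hη
  suffices h : η ∈ (fun a => ω.gnsStarAlgHom a (gnsVector ω)) '' (twistedFixedPoints θ w : Set A) by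
    obtain ⟨a, ha, rfl⟩ := h
    exact ⟨a, ha, rfl⟩
  rw [← (hω.isClosed_range_gns hw).closure_eq, Metric.mem_closure_iff]
  intro ε hε
  let J : A →L[ℂ] ω.GNS := (ContinuousLinearMap.apply ℂ ω.GNS (gnsVector ω)).comp
    ⟨ω.gnsStarAlgHom.toAlgHom.toLinearMap,
      map_continuous ω.gnsStarAlgHom⟩
  have hJ : ∀ a, J a = ω.gnsStarAlgHom a (gnsVector ω) := fun _ => rfl
  obtain ⟨b₀, hb₀⟩ : ∃ b₀ : ω.PreGNS, dist η (b₀ : ω.GNS) < ε / 2 :=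
    UniformSpace.Completion.denseRange_coe.exists_dist_lt η (half_pos hε)
  let E := J.comp (CrossedProduct.coefficient α n)
  obtain ⟨b, hb⟩ := coefficient_surjective α n (ω.ofPreGNS b₀)
  have hEb : E b = (b₀ : ω.GNS) := by
    change J (CrossedProduct.coefficient α n b) = _
    rw [hb, hJ, gnsStarAlgHom_gnsVector]
    rfl
  have hEΦ : ∀ y, E (skewProduct θ α u hu y) = U (E y) := fun y => by
    change J (CrossedProduct.coefficient α n _) = U (J _)
    rw [coefficient_skewProduct, hJ, hJ, twistedCovariantIsometry_gns]
    rfl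
  -- The tolerance leaves an error below `ε / 2` after applying `E`; the `+ 1` covers `E = 0`.
  obtain ⟨x, y, hx, hxy⟩ := hΦ.exists_norm_sub_lt b
    (show 0 < ε / 2 / (‖E‖ + 1) by positivity)
  refine ⟨E x, ⟨CrossedProduct.coefficient α n x, ?_, rfl⟩, ?_⟩
  · have := coefficient_skewProduct θ α u hu n x
    rw [hx] at this
    exact this.symm
  · have h1 : ‖E b - (E x + (E y - U (E y)))‖ < ε / 2 := by
      rw [← hEΦ, ← map_sub, ← map_add, ← map_sub]
      refine (E.le_opNorm _).trans_lt ?_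
      rw [lt_div_iff₀ (by positivity)] at hxy
      nlinarith [norm_nonneg (b - (x + (y - skewProduct θ α u hu y))), norm_nonneg E]
    have hz : U (η - E x) = η - E x := by rw [map_sub, hUη, ← hEΦ, hx]
    rw [dist_eq_norm]
    -- Adding the coboundary of `-E y` to `η - E x` gives `η - E b` plus the error in `h1`, each
    -- below `ε / 2`.
    refine (norm_le_norm_add_sub_map U hz (-E y)).trans_lt ?_
    have h2 : η - E x + (-E y - U (-E y)) = (η - E b) + (E b - (E x + (E y - U (E y)))) := by
      rw [map_neg]; abel
    rw [h2]
    rw [dist_eq_norm, ← hEb] at hb₀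
    linarith [norm_add_le (η - E b) (E b - (E x + (E y - U (E y))))]
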